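/- Let $\theta\in(0,1]$, let $\lambda:[0,\infty)\to[0,\infty)$ be locally integrable with $\Lambda_t=\int_0^t\lambda_u\,du$, and let $a:[0,\infty)\to\mathbb R$ be measurable with $0\le a_t\le 1+1/\theta$ for all $t\ge0$. For each $t\ge 0$ let $p_t$ be the probability distribution on $\{0,2,3,\dots\}$ with generating function $$h_t(s)=\sum_{k}p_t(k)s^k=1-a_t(1-s)+\frac{a_t}{1+\theta}(1-s)^{1+\theta},\qquad 0\le s\le 1 .$$ Let $(Z_t)_{t\ge0}$ be the theta-positive branching process with branching parameter $\theta$ in the varying environment $(\{\lambda_t\},\{a_t\})$, that is, the time inhomogeneous Markov branching process with $Z_0=1$ in which, independently of each other, individuals alive at time $t$ die at rate $\lambda_t$, and an individual dying at time $t$ is instantaneously replaced by $k$ individuals with probability $p_t(k)$. (Equivalently, $Z$ is the càdlàg process with values in $\{0,1,2,\dots\}$ and $Z_0=1$ that jumps from $n$ to $n+k-1$ at rate $n\lambda_t p_t(k)$ at time $t$; it is specified as the solution of the corresponding martingale problem with finitely supported test functions.) Put $\mu_t=\mathrm E(Z_t)$. If $\lim_{t\to\infty}\Lambda_t=\infty$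 and $0<\liminf_{t\to\infty}\mu_t\le\limsup_{t\to\infty}\mu_t<\infty$, then $Z$ is critical: the extinction probability $q=\lim_{t\to\infty}\mathrm P(Z_t=0)$ equals $1$, and $m_t=\mathrm E(Z_t\mid Z_t>0)\to\infty$ as $t\to\infty$. -/

import Mathlib

open MeasureTheory ProbabilityTheory Filter Topology Set
open scoped NNReal ENNReal

/-- `Λ_t = ∫₀ᵗ λ_u du`, the cumulative hazard function of the life length of the initial
individual, for the death rate `rate = λ`. -/
noncomputable def cumHazard (rate : ℝ → ℝ) (t : ℝ) : ℝ := ∫ u in (0 : ℝ)..t, rate u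

/-- A family `p t k` (`t ≥ 0`) of reproduction laws: at each time `t`, `p t` is a probability
distribution on the possible offspring numbers `k = 0` and `k ≥ 2`. -/
structure IsReproductionLaw (p : ℝ → ℕ → ℝ) : Prop where
  nonneg : ∀ t, 0 ≤ t → ∀ k, 0 ≤ p t k
  hasSum_one : ∀ t, 0 ≤ t → HasSum (p t) 1
  one_eq_zero : ∀ t, 0 ≤ t → p t 1 = 0

/-- The time-dependent generator at time `u` of the branching population: in a population of size
`n`, each individual dies at rate `rate u`, and it is then replaced by `k` individuals with
probability `p u k`, so that `n` jumps to `n + k - 1` at rate `n * rate u * p u k`.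
(For `n = 0` the factor `n` makes the value `0`, hence `n + k - 1` is never truncated.) -/
noncomputable def branchingGenerator (rate : ℝ → ℝ) (p : ℝ → ℕ → ℝ) (f : ℕ → ℝ) (u : ℝ)
    (n : ℕ) : ℝ :=
  n * rate u * ∑' k, p u k * (f (n + k - 1) - f n)

/-- `Z` is the (time inhomogeneous) Markov branching process in the varying environment with death
rates `rate` and reproduction laws `p`, started from one individual: an adapted process with values
in `ℕ` and right-continuous paths with left limits, which solves the martingale problem of the
generator above, with the finitely supported functions as test functions.  Since `Z` takes finite
values at all times, the process does not explode. -/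
structure IsMarkovBranchingProcess {Ω : Type*} [mΩ : MeasurableSpace Ω] (rate : ℝ → ℝ)
    (p : ℝ → ℕ → ℝ) (ℱ : Filtration ℝ≥0 mΩ) (P : Measure Ω) (Z : ℝ≥0 → Ω → ℕ) : Prop where
  adapted : ∀ t, Measurable[ℱ t] (Z t)
  initial : ∀ᵐ ω ∂P, Z 0 ω = 1
  right_continuous : ∀ ω t, ContinuousWithinAt (fun u => Z u ω) (Ioi t) t
  left_limits : ∀ ω t, ∃ l, Tendsto (fun u => Z u ω) (𝓝[<] t) (𝓝 l)
  martingale : ∀ f : ℕ → ℝ, f.support.Finite →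
    Martingale
      (fun (t : ℝ≥0) ω => f (Z t ω) -
        ∫ u in (0 : ℝ)..(t : ℝ), branchingGenerator rate p f u (Z u.toNNReal ω)) ℱ P

/-- The generating function `h(s) = 1 - a (1 - s) + a (1 + θ)⁻¹ (1 - s)^(1 + θ)`. -/
noncomputable def thetaPGF (θ a s : ℝ) : ℝ :=
  1 - a * (1 - s) + a * (1 + θ)⁻¹ * (1 - s) ^ (1 + θ)

/-- `Z` is a theta-positive branching process with branching parameter `θ ∈ (0, 1]` in the varying
environment `({λ_t}, {a_t})`, where `rate = λ` is locally integrable and `0 ≤ a_t ≤ 1 + 1 / θ`. -/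
structure IsThetaPositiveBranchingProcess {Ω : Type*} [mΩ : MeasurableSpace Ω] (θ : ℝ)
    (rate a : ℝ → ℝ) (ℱ : Filtration ℝ≥0 mΩ) (P : Measure Ω) (Z : ℝ≥0 → Ω → ℕ) : Prop where
  theta_pos : 0 < θ
  theta_le_one : θ ≤ 1
  rate_nonneg : ∀ t, 0 ≤ t → 0 ≤ rate t
  rate_integrable : ∀ t, 0 ≤ t → IntervalIntegrable rate volume 0 t
  a_measurable : Measurable a
  a_nonneg : ∀ t, 0 ≤ t → 0 ≤ a t
  a_le : ∀ t, 0 ≤ t → a t ≤ 1 + 1 / θ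
  branching : ∃ p : ℝ → ℕ → ℝ, IsReproductionLaw p ∧
    (∀ t, 0 ≤ t → ∀ s ∈ Icc (0 : ℝ) 1, HasSum (fun k => p t k * s ^ k) (thetaPGF θ (a t) s)) ∧
    IsMarkovBranchingProcess rate p ℱ P Z

/-- The mean population size `μ_t = E(Z_t)`, as an element of `[0, ∞]`. -/
noncomputable def meanSize {Ω : Type*} [MeasurableSpace Ω] (P : Measure Ω) (Z : ℝ≥0 → Ω → ℕ)
    (t : ℝ≥0) : ℝ≥0∞ :=
  ∫⁻ ω, (Z t ω : ℝ≥0∞) ∂P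

/-- `m_t = E(Z_t | Z_t > 0)`, as an element of `[0, ∞]`. -/
noncomputable def condMeanSize {Ω : Type*} [MeasurableSpace Ω] (P : Measure Ω)
    (Z : ℝ≥0 → Ω → ℕ) (t : ℝ≥0) : ℝ≥0∞ :=
  ∫⁻ ω, (Z t ω : ℝ≥0∞) ∂(P[|{ω | 0 < Z t ω}])

/-- The branching process `Z` is critical: its extinction probability `q = lim P(Z_t = 0)` is `1`,
and `m_t → ∞`. -/
def IsCriticalBranching {Ω : Type*} [MeasurableSpace Ω] (P : Measure Ω) (Z : ℝ≥0 → Ω → ℕ) :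
    Prop :=
  Tendsto (fun t => P {ω | Z t ω = 0}) atTop (𝓝 1) ∧
    Tendsto (condMeanSize P Z) atTop (𝓝 ⊤)

/-! The process has an explicit generating function. With `g` the growth exponent, put μ = exp(g)
and B_t = θ/(1+θ) ∫₀ᵗ a λ μ^(-θ) du. Then E(s^(Z_t)) = 1 - (B_t + (1-s)^(-θ) μ_t^(-θ))^(-1/θ) for 0
≤ s < 1 (`hasSum_pointProb_mul_pow`). Letting s increase to 1 identifies μ as the mean
(`meanSize_thetaPositive`), and s = 0 gives P(Z_t > 0) = (B_t + μ_t^(-θ))^(-1/θ)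
(`measure_extinct_thetaPositive`).

Since ∫₀ᵗ a λ du = g(t) + Λ_t, a mean bounded away from 0 and ∞ together with Λ → ∞ forces B → ∞
(`tendsto_thetaVariation_atTop`). Hence survival has vanishing probability, and m_t = μ_t / P(Z_t >
0) → ∞.

For the formula, indicators of single states in the martingale problem yield the forward equations
(`IsMarkovBranchingProcess.forward_equation`). Formally the generating function F then satisfies ∂_t
F = λ (h(s) - s) ∂_s F, so it is constant along curves with r' = λ (r - h(r)). As the environment is
only measurable, `hasSum_characteristic` proves this with partial sums, absolute continuity and
dominated convergence. For the theta law, 1 - r solves a Bernoulli equation with an explicit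
solution (`IsThetaEnvironment.characteristic_hasDerivAt`). -/

/-! ### Measurability of the reproduction laws and of the process -/

/-- A power series which vanishes on `[0, 1]` has vanishing coefficients. -/
theorem eq_zero_of_hasSum_pow_eq_zero {b : ℕ → ℝ}
    (hb : ∀ s ∈ Icc (0 : ℝ) 1, HasSum (fun k => b k * s ^ k) 0) (n : ℕ) : b n = 0 := by
  have hsum : Summable fun k => |b k| := by
    have := (hb 1 (by simp)).summable
    simp only [one_pow, mul_one] at this
    exact this.abs
  set M := ∑' k, |b k| with hM
  induction n using Nat.strong_induction_on with
  | _ n ih =>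
    -- Once the lower coefficients vanish, `b n * s ^ n` is minus the tail, which is at most `s ^ (n
    -- + 1) * M`; divide by `s ^ n` and let `s` tend to 0.
    have key : ∀ s ∈ Ioc (0 : ℝ) 1, |b n| ≤ s * M := by
      intro s hs
      have h0 := hb s ⟨hs.1.le, hs.2⟩
      have h1 : HasSum (fun k => b (k + (n + 1)) * s ^ (k + (n + 1))) (0 - b n * s ^ n) := by
        have h' := (hasSum_nat_add_iff' (n + 1)).2 h0
        rw [Finset.sum_range_succ, Finset.sum_eq_zero, zero_add] at h'
        · exact h'
        · intro k hk
          rw [ih k (Finset.mem_range.1 hk), zero_mul]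
      have h2 : Summable fun k => |b (k + (n + 1))| := 
        (summable_nat_add_iff (f := fun k => |b k|) (n + 1)).2 hsum
      have h3 : |0 - b n * s ^ n| ≤ s ^ (n + 1) * M := by
        rw [← h1.tsum_eq]
        have hle : ∀ k, ‖b (k + (n + 1)) * s ^ (k + (n + 1))‖ ≤
            s ^ (n + 1) * |b (k + (n + 1))| := by
          intro k
          rw [Real.norm_eq_abs, abs_mul, abs_of_nonneg (pow_nonneg hs.1.le _), mul_comm]
          exact mul_le_mul_of_nonneg_right
            (pow_le_pow_of_le_one hs.1.le hs.2 (Nat.le_add_left _ _)) (abs_nonneg _)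
        refine (tsum_of_norm_bounded (h2.mul_left _).hasSum hle).trans ?_
        rw [tsum_mul_left]
        refine mul_le_mul_of_nonneg_left ?_ (pow_nonneg hs.1.le _)
        have := hsum.sum_add_tsum_nat_add (n + 1)
        have h5 : 0 ≤ ∑ i ∈ Finset.range (n + 1), |b i| :=
          Finset.sum_nonneg fun _ _ => abs_nonneg _
        rw [hM]
        linarith
      rw [zero_sub, abs_neg, abs_mul, abs_of_nonneg (pow_nonneg hs.1.le _), pow_succ] at h3
      have hp : 0 < s ^ n := pow_pos hs.1 n
      refine le_of_mul_le_mul_right ?_ hp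
      linarith
    have hlim : Tendsto (fun s : ℝ => s * M) (𝓝[>] 0) (𝓝 0) := by
      have : Tendsto (fun s : ℝ => s * M) (𝓝 0) (𝓝 (0 * M)) := tendsto_id.mul_const M
      rw [zero_mul] at this
      exact this.mono_left nhdsWithin_le_nhds
    have hle : |b n| ≤ 0 := by
      refine ge_of_tendsto hlim ?_
      filter_upwards [Ioc_mem_nhdsGT (zero_lt_one' ℝ)] with s hs using key s hs
    exact abs_nonpos_iff.1 hle

/-- The theta-positive reproduction laws depend affinely on the parameter `a`. -/
theorem exists_thetaPGF_coeff {θ : ℝ} {a : ℝ → ℝ} {p : ℝ → ℕ → ℝ}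
    (hp : ∀ t, 0 ≤ t → ∀ s ∈ Icc (0 : ℝ) 1,
      HasSum (fun k => p t k * s ^ k) (thetaPGF θ (a t) s)) :
    ∃ c : ℕ → ℝ, ∀ t, 0 ≤ t → ∀ k, p t k = (if k = 0 then 1 else 0) + a t * c k := by
  have hδ : ∀ s : ℝ, HasSum (fun k : ℕ => (if k = 0 then (1 : ℝ) else 0) * s ^ k) 1 := by
    intro s
    convert hasSum_ite_eq 0 (1 : ℝ) using 2 with k
    split_ifs with h <;> simp [h]
  have huniq : ∀ (t : ℝ), 0 ≤ t → ∀ (d : ℕ → ℝ),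
      (∀ s ∈ Icc (0 : ℝ) 1, HasSum (fun k => d k * s ^ k) (thetaPGF θ (a t) s - 1)) →
      ∀ k, p t k = (if k = 0 then 1 else 0) + d k := by
    intro t ht d hd k
    have := eq_zero_of_hasSum_pow_eq_zero
      (b := fun k => p t k - ((if k = 0 then 1 else 0) + d k)) (fun s hs => by
        have h := (hp t ht s hs).sub ((hδ s).add (hd s hs))
        rw [add_sub_cancel, sub_self] at h
        exact h.congr_fun fun k => by ring) k
    linarith
  by_cases h : ∃ t₀, 0 ≤ t₀ ∧ a t₀ ≠ 0
  · obtain ⟨t₀, ht₀, ha₀⟩ := h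
    -- h - 1 is linear in a, so a single time with a ≠ 0 determines the coefficients for all times.
    refine ⟨fun k => (p t₀ k - if k = 0 then 1 else 0) / a t₀, fun t ht => ?_⟩
    refine huniq t ht _ fun s hs => ?_
    have h := ((hp t₀ ht₀ s hs).sub (hδ s)).mul_left (a t / a t₀)
    have he : a t / a t₀ * (thetaPGF θ (a t₀) s - 1) = thetaPGF θ (a t) s - 1 := by
      simp only [thetaPGF]
      field_simp
      ring
    rw [he] at h
    exact h.congr_fun fun k => by ring
  · push Not at h
    refine ⟨fun _ => 0, fun t ht => ?_⟩
    refine huniq t ht _ fun s hs => ?_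
    simp [thetaPGF, h t ht]

/-- A right-continuous process of random integers is jointly measurable. -/
theorem measurable_uncurry_of_rightContinuous {Ω : Type*} [MeasurableSpace Ω]
    {Z : ℝ≥0 → Ω → ℕ} (hm : ∀ t, Measurable (Z t))
    (hr : ∀ ω t, ContinuousWithinAt (fun u => Z u ω) (Ioi t) t) :
    Measurable fun q : ℝ≥0 × Ω => Z q.1 q.2 := by
  obtain ⟨e, he⟩ : ∃ e : ℕ → ℕ → ℝ≥0, ∀ k n, e k n = ((n : ℝ≥0) + 1) / (k + 1) :=
    ⟨_, fun _ _ => rfl⟩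
  -- `d k t` is the first point of the grid of mesh 1/(k+1) strictly after `t`; strictness matters
  -- because continuity is given within `Ioi t`.
  set d : ℕ → ℝ≥0 → ℝ≥0 := fun k t => e k ⌊t * (k + 1)⌋₊ with hd_def
  have hd : ∀ t, Tendsto (fun k => d k t) atTop (𝓝[>] t) := by
    intro t
    have hlt : ∀ k, t < d k t := fun k => by
      simp only [hd_def, he]
      rw [lt_div_iff₀ (by positivity)]
      exact Nat.lt_floor_add_one _
    have hle : ∀ k, d k t ≤ t + 1 / ((k : ℝ≥0) + 1) := fun k => by
      simp only [hd_def, he]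
      rw [div_le_iff₀ (by positivity), add_mul, one_div, inv_mul_cancel₀ (by positivity)]
      gcongr
      exact Nat.floor_le (zero_le)
    refine tendsto_nhdsWithin_iff.2 ⟨?_, Eventually.of_forall hlt⟩
    refine tendsto_of_tendsto_of_tendsto_of_le_of_le tendsto_const_nhds ?_
      (fun k => (hlt k).le) hle
    simpa using (tendsto_one_div_add_atTop_nhds_zero_nat (𝕜 := ℝ≥0)).const_add t
  refine measurable_of_tendsto_metrizable (f := fun k (q : ℝ≥0 × Ω) => Z (d k q.1) q.2)
    (fun k => ?_) (tendsto_pi_nhds.2 fun q => (hr q.2 q.1).tendsto.comp (hd q.1))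
  have h1 : ∀ (W : ℕ → Ω → ℕ) (f : ℝ≥0 → ℕ), (∀ n, Measurable (W n)) → Measurable f →
      Measurable fun q : ℝ≥0 × Ω => W (f q.1) q.2 := fun W f hW hf =>
    (measurable_from_prod_countable_right (f := fun q : ℕ × Ω => W q.1 q.2) hW).comp
      ((hf.comp measurable_fst).prodMk measurable_snd)
  have h2 : Measurable fun t : ℝ≥0 => ⌊t * (k + 1)⌋₊ :=
    Nat.measurable_floor.comp (measurable_id.mul_const _)
  exact h1 (fun n => Z (e k n)) _ (fun n => hm _) h2

/-! ### The Kolmogorov forward equation -/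

/-- The probability that the process `Z` is in state `n` at time `u`. -/
noncomputable def pointProb {Ω : Type*} [MeasurableSpace Ω] (P : Measure Ω) (Z : ℝ≥0 → Ω → ℕ)
    (n : ℕ) (u : ℝ) : ℝ :=
  P.real {ω | Z u.toNNReal ω = n}

/-- The right-hand side of the Kolmogorov forward equation for state `n`, for the one-dimensional
distributions `π`. -/
noncomputable def forwardRate (rate : ℝ → ℝ) (p : ℝ → ℕ → ℝ) (π : ℕ → ℝ → ℝ) (n : ℕ) (u : ℝ) :
    ℝ :=
  rate u * (∑ j ∈ Finset.range (n + 1), (j + 1) * π (j + 1) u * p u (n - j) - n * π n u)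

theorem IsReproductionLaw.le_one {p : ℝ → ℕ → ℝ} (hp : IsReproductionLaw p) {u : ℝ} (hu : 0 ≤ u)
    (k : ℕ) : p u k ≤ 1 :=
  le_hasSum (hp.hasSum_one u hu) k fun j _ => hp.nonneg u hu j

/-- From `l + 1` individuals, state `n` is reached by exactly one offspring number, `n - l`, and
only if `l ≤ n`. The generator series therefore collapses, which makes the forward rate a finite
sum. -/
theorem branchingGenerator_indicator {rate : ℝ → ℝ} {p : ℝ → ℕ → ℝ} (hp : IsReproductionLaw p)
    {u : ℝ} (hu : 0 ≤ u) (n m : ℕ) :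
    branchingGenerator rate p (fun i => if i = n then 1 else 0) u m =
      forwardRate rate p (fun i _ => if m = i then 1 else 0) n u := by
  unfold branchingGenerator forwardRate
  rcases m with _ | l
  · by_cases hn : n = 0
    · simp [hn]
    · simp [Ne.symm hn]
  · have hl : (l + 1 : ℕ) * rate u = rate u * (l + 1 : ℕ) := mul_comm _ _
    rw [hl, mul_assoc]
    congr 1
    have h2 : HasSum (fun k => p u k * (if l + 1 = n then 1 else 0)) (if l + 1 = n then 1 else 0) :=
      by simpa using (hp.hasSum_one u hu).mul_right (if l + 1 = n then (1 : ℝ) else 0)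
    have h1 : HasSum (fun k => p u k * (if l + 1 + k - 1 = n then 1 else 0))
        (if l ≤ n then p u (n - l) else 0) := by
      split_ifs with hln
      · refine (hasSum_ite_eq (n - l) (p u (n - l))).congr_fun fun k => ?_
        by_cases hk : k = n - l
        · subst hk
          have : l + 1 + (n - l) - 1 = n := by omega
          simp [this]
        · have : l + 1 + k - 1 ≠ n := by omega
          rw [if_neg this, if_neg hk, mul_zero]
      · refine hasSum_zero.congr_fun fun k => ?_
        have : l + 1 + k - 1 ≠ n := by omega
        rw [if_neg this, mul_zero]
    have h3 := h1.sub h2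
    simp only [← mul_sub] at h3
    rw [h3.tsum_eq, mul_sub]
    congr 1
    · split_ifs with hln
      · rw [Finset.sum_eq_single l]
        · simp
        · intro b _ hb
          have : l ≠ b := Ne.symm hb
          simp [this]
        · intro h
          exact absurd (Finset.mem_range.2 (Nat.lt_succ_of_le hln)) h
      · rw [mul_zero, Finset.sum_eq_zero]
        intro j hj
        have : l ≠ j := by
          have := Finset.mem_range.1 hj
          omega
        simp [this]
    · dsimp only
      split_ifs with h
      · rw [h, mul_comm]
      · rw [mul_zero, mul_zero]

section Forward

variable {Ω : Type*} [mΩ : MeasurableSpace Ω] {P : Measure Ω}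
  {ℱ : Filtration ℝ≥0 mΩ} {rate : ℝ → ℝ} {p : ℝ → ℕ → ℝ} {Z : ℝ≥0 → Ω → ℕ}

theorem IsMarkovBranchingProcess.measurable (hZ : IsMarkovBranchingProcess rate p ℱ P Z)
    (t : ℝ≥0) : Measurable (Z t) :=
  (hZ.adapted t).mono (ℱ.le t) le_rfl

theorem IsMarkovBranchingProcess.measurable_uncurry (hZ : IsMarkovBranchingProcess rate p ℱ P Z) :
    Measurable fun q : ℝ × Ω => Z q.1.toNNReal q.2 :=
  (measurable_uncurry_of_rightContinuous hZ.measurable hZ.right_continuous).comp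
    ((measurable_real_toNNReal.comp measurable_fst).prodMk measurable_snd)

theorem integral_eq_pointProb (hZ : ∀ t, Measurable (Z t)) (n : ℕ) (u : ℝ) :
    ∫ ω, (if Z u.toNNReal ω = n then (1 : ℝ) else 0) ∂P = pointProb P Z n u := by
  have hs : MeasurableSet {ω | Z u.toNNReal ω = n} := hZ _ (measurableSet_singleton n)
  rw [pointProb, ← integral_indicator_one hs]
  simp only [indicator_apply, mem_ofPred_eq, Pi.one_apply]

variable [IsProbabilityMeasure P]

theorem integrable_eq_indicator (hZ : ∀ t, Measurable (Z t)) (n : ℕ) (u : ℝ) :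
    Integrable (fun ω => if Z u.toNNReal ω = n then (1 : ℝ) else 0) P := by
  have hs : MeasurableSet {ω | Z u.toNNReal ω = n} := hZ _ (measurableSet_singleton n)
  refine ((integrable_const (μ := P) (1 : ℝ)).indicator hs).congr (Eventually.of_forall fun ω => ?_)
  simp only [indicator_apply, mem_ofPred_eq]

theorem integral_forwardRate (hZ : ∀ t, Measurable (Z t)) (n : ℕ) (u : ℝ) :
    ∫ ω, forwardRate rate p (fun i v => if Z v.toNNReal ω = i then 1 else 0) n u ∂P =
      forwardRate rate p (pointProb P Z) n u := by
  unfold forwardRate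
  rw [integral_const_mul, integral_sub, integral_finsetSum, integral_const_mul,
    integral_eq_pointProb hZ]
  · congr 3
    ext j
    rw [integral_mul_const, integral_const_mul, integral_eq_pointProb hZ]
  · exact fun j _ => ((integrable_eq_indicator hZ _ u).const_mul _).mul_const _
  · exact integrable_finsetSum _ fun j _ =>
      ((integrable_eq_indicator hZ _ u).const_mul _).mul_const _
  · exact (integrable_eq_indicator hZ _ u).const_mul _

/-- Only finitely many states feed state `n`, so the integrand is a finite combination of λ times
bounded factors; no moment of `Z` is needed for Fubini. -/
theorem IsMarkovBranchingProcess.integrable_forwardRate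
    (hZ : IsMarkovBranchingProcess rate p ℱ P Z) (hp : IsReproductionLaw p) {T : ℝ}
    (hrate : IntegrableOn rate (Ioc 0 T))
    (hpm : ∀ k, AEStronglyMeasurable (fun u => p u k) (volume.restrict (Ioc 0 T))) (n : ℕ) :
    Integrable (fun q : ℝ × Ω =>
        forwardRate rate p (fun i v => if Z v.toNNReal q.2 = i then 1 else 0) n q.1)
      ((volume.restrict (Ioc 0 T)).prod P) := by
  have hrp : ∀ k, Integrable (fun u => rate u * p u k) (volume.restrict (Ioc 0 T)) := fun k => by
    refine Integrable.mul_bdd (c := 1) hrate (hpm k) ?_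
    filter_upwards [ae_restrict_mem measurableSet_Ioc] with u hu
    rw [Real.norm_eq_abs, abs_of_nonneg (hp.nonneg u hu.1.le k)]
    exact hp.le_one hu.1.le k
  have hind : ∀ (f : ℝ → ℝ) (i : ℕ), Integrable f (volume.restrict (Ioc 0 T)) →
      Integrable (fun q : ℝ × Ω => f q.1 * (if Z q.1.toNNReal q.2 = i then 1 else 0))
        ((volume.restrict (Ioc 0 T)).prod P) := by
    intro f i hf
    refine Integrable.mul_bdd (c := 1) (hf.comp_fst P) ?_ ?_
    · have hs : MeasurableSet {q : ℝ × Ω | Z q.1.toNNReal q.2 = i} :=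
        hZ.measurable_uncurry (measurableSet_singleton i)
      exact (Measurable.ite hs measurable_const measurable_const).aestronglyMeasurable
    · refine Eventually.of_forall fun q => ?_
      split_ifs <;> simp
  have h := (integrable_finsetSum (Finset.range (n + 1)) fun j _ =>
    (hind _ (j + 1) (hrp (n - j))).const_mul ((j : ℝ) + 1)).sub
      ((hind _ n hrate).const_mul (n : ℝ))
  refine h.congr (Eventually.of_forall fun q => ?_)
  simp only [forwardRate, Pi.sub_apply, mul_sub, Finset.mul_sum]
  congr 1
  · exact Finset.sum_congr rfl fun j _ => by ring
  · ring

theorem IsMarkovBranchingProcess.integrableOn_forwardRate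
    (hZ : IsMarkovBranchingProcess rate p ℱ P Z) (hp : IsReproductionLaw p) {T : ℝ}
    (hrate : IntegrableOn rate (Ioc 0 T))
    (hpm : ∀ k, AEStronglyMeasurable (fun u => p u k) (volume.restrict (Ioc 0 T))) (n : ℕ) :
    IntegrableOn (forwardRate rate p (pointProb P Z) n) (Ioc 0 T) := by
  have h := (hZ.integrable_forwardRate hp hrate hpm n).integral_prod_left
  simp only [integral_forwardRate hZ.measurable] at h
  exact h

/-- The Kolmogorov forward equation in integrated form. -/
theorem IsMarkovBranchingProcess.forward_equation
    (hZ : IsMarkovBranchingProcess rate p ℱ P Z) (hp : IsReproductionLaw p) {T : ℝ} (hT : 0 ≤ T)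
    (hrate : IntegrableOn rate (Ioc 0 T))
    (hpm : ∀ k, AEStronglyMeasurable (fun u => p u k) (volume.restrict (Ioc 0 T))) (n : ℕ) :
    pointProb P Z n T = (if n = 1 then 1 else 0) +
      ∫ u in 0..T, forwardRate rate p (pointProb P Z) n u := by
  have hint := hZ.integrable_forwardRate hp hrate hpm n
  have hM := hZ.martingale (fun i => if i = n then 1 else 0)
    ((finite_singleton n).subset fun i hi => by
      by_contra h
      have h' : i ≠ n := h
      simp [h'] at hi)
  -- The martingale has equal means at times 0 and `T`; Fubini turns this into the integrated
  -- equation.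
  have hE := hM.setIntegral_eq (zero_le : (0 : ℝ≥0) ≤ T.toNNReal) MeasurableSet.univ
  simp only [Measure.restrict_univ, NNReal.coe_zero, intervalIntegral.integral_same, sub_zero,
    Real.coe_toNNReal T hT] at hE
  have hgen : ∀ ω, ∫ u in 0..T,
      branchingGenerator rate p (fun i => if i = n then 1 else 0) u (Z u.toNNReal ω) =
      ∫ u in Ioc 0 T, forwardRate rate p (fun i v => if Z v.toNNReal ω = i then 1 else 0) n u := by
    intro ω
    rw [intervalIntegral.integral_of_le hT]
    refine setIntegral_congr_fun measurableSet_Ioc fun u hu => ?_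
    exact branchingGenerator_indicator hp hu.1.le n _
  simp only [hgen] at hE
  have h0 : ∫ ω, (if Z 0 ω = n then (1 : ℝ) else 0) ∂P = if n = 1 then 1 else 0 := by
    have : (fun ω => if Z 0 ω = n then (1 : ℝ) else 0) =ᵐ[P] fun _ => if n = 1 then 1 else 0 := by
      filter_upwards [hZ.initial] with ω hω
      simp [hω, eq_comm]
    rw [integral_congr_ae this]
    simp
  have hswap : ∫ ω, (∫ u in Ioc 0 T,
      forwardRate rate p (fun i v => if Z v.toNNReal ω = i then 1 else 0) n u) ∂P =
      ∫ u in Ioc 0 T, forwardRate rate p (pointProb P Z) n u := by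
    rw [← integral_integral_swap (f := fun u ω =>
      forwardRate rate p (fun i v => if Z v.toNNReal ω = i then 1 else 0) n u) hint]
    simp only [integral_forwardRate hZ.measurable]
  rw [h0, integral_sub (integrable_eq_indicator hZ.measurable n T) hint.integral_prod_right,
    integral_eq_pointProb hZ.measurable, hswap] at hE
  rw [intervalIntegral.integral_of_le hT]
  linarith

end Forward

/-! ### Transport along characteristics -/

theorem summable_succ_mul_pow {ρ : ℝ} (h0 : 0 ≤ ρ) (h1 : ρ < 1) :
    Summable fun j : ℕ => ((j : ℝ) + 1) * ρ ^ j := by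
  have h := summable_pow_mul_geometric_of_norm_lt_one 1 (r := ρ) (by
    rwa [Real.norm_eq_abs, abs_of_nonneg h0])
  have h' := summable_geometric_of_lt_one h0 h1
  exact (h.add h').congr fun j => by ring

/-- The truncated generating function of the forward equation along a characteristic: the partial
sums are bounded, and they tend to zero. -/
theorem characteristic_partialSum {x q : ℕ → ℝ} {r ρ : ℝ} (hx0 : ∀ n, 0 ≤ x n)
    (hx1 : ∀ n, x n ≤ 1) (hq0 : ∀ n, 0 ≤ q n) (hq1 : HasSum q 1) (hr0 : 0 ≤ r) (hrρ : r ≤ ρ)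
    (hρ : ρ < 1) :
    (∀ N, |∑ n ∈ Finset.range N,
      ((∑ j ∈ Finset.range (n + 1), (j + 1) * x (j + 1) * q (n - j) - n * x n) * r ^ n +
        x n * (n * r ^ (n - 1) * (r - ∑' k, q k * r ^ k)))| ≤ ∑' j : ℕ, ((j : ℝ) + 1) * ρ ^ j) ∧
    Tendsto (fun N => ∑ n ∈ Finset.range N,
      ((∑ j ∈ Finset.range (n + 1), (j + 1) * x (j + 1) * q (n - j) - n * x n) * r ^ n +
        x n * (n * r ^ (n - 1) * (r - ∑' k, q k * r ^ k)))) atTop (𝓝 0) := by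
  have hρ0 := hr0.trans hrρ
  have hr1 : r ≤ 1 := hrρ.trans hρ.le
  set A : ℕ → ℝ := fun j => (j + 1) * x (j + 1) * r ^ j with hA
  set B : ℕ → ℝ := fun k => q k * r ^ k with hB
  have hA0 : ∀ j, 0 ≤ A j := fun j =>
    mul_nonneg (mul_nonneg (by positivity) (hx0 _)) (pow_nonneg hr0 _)
  have hB0 : ∀ j, 0 ≤ B j := fun j => mul_nonneg (hq0 _) (pow_nonneg hr0 _)
  have hAle : ∀ j, A j ≤ ((j : ℝ) + 1) * ρ ^ j := fun j => by
    refine mul_le_mul ?_ (pow_le_pow_left₀ hr0 hrρ j) (pow_nonneg hr0 _) (by positivity)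
    exact mul_le_of_le_one_right (by positivity) (hx1 _)
  have hBle : ∀ j, B j ≤ q j := fun j =>
    mul_le_of_le_one_right (hq0 j) (pow_le_one₀ hr0 hr1)
  have hsC := summable_succ_mul_pow hρ0 hρ
  have hsA : Summable A := Summable.of_nonneg_of_le hA0 hAle hsC
  have hsB : Summable B := Summable.of_nonneg_of_le hB0 hBle hq1.summable
  set C := ∑' j : ℕ, ((j : ℝ) + 1) * ρ ^ j
  set H := ∑' j, A j
  set h := ∑' k, B k
  have hH0 : 0 ≤ H := tsum_nonneg hA0
  have hh0 : 0 ≤ h := tsum_nonneg hB0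
  have hHC : H ≤ C := hsA.tsum_le_tsum hAle hsC
  have hh1 : h ≤ 1 := by
    rw [← hq1.tsum_eq]
    exact hsB.tsum_le_tsum hBle hq1.summable
  -- The inflow is the Cauchy product of the series for F'(r) and h(r). The shifted series below is
  -- again F'(r), so gain and loss both sum to F'(r) h(r) and cancel in the limit.
  have hconv : HasSum (fun n => ∑ j ∈ Finset.range (n + 1), A j * B (n - j)) (H * h) :=
    hasSum_sum_range_mul_of_summable_norm hsA.norm hsB.norm
  have hshift : HasSum (fun n : ℕ => n * x n * r ^ (n - 1)) H := by
    rw [← hasSum_nat_add_iff' 1]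
    simpa [hA] using hsA.hasSum
  have hterm : ∀ n : ℕ,
      (∑ j ∈ Finset.range (n + 1), (j + 1) * x (j + 1) * q (n - j) - n * x n) * r ^ n +
        x n * (n * r ^ (n - 1) * (r - h)) =
      ∑ j ∈ Finset.range (n + 1), A j * B (n - j) - n * x n * r ^ (n - 1) * h := by
    intro n
    have h1 : ∑ j ∈ Finset.range (n + 1), A j * B (n - j) =
        (∑ j ∈ Finset.range (n + 1), (j + 1) * x (j + 1) * q (n - j)) * r ^ n := by
      rw [Finset.sum_mul]
      refine Finset.sum_congr rfl fun j hj => ?_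
      have hj' : j ≤ n := Nat.lt_succ_iff.1 (Finset.mem_range.1 hj)
      rw [← Nat.add_sub_cancel' hj', pow_add, hA, hB]
      simp only [Nat.add_sub_cancel_left]
      ring
    have h2 : (n : ℝ) * r ^ n = n * r ^ (n - 1) * r := by
      rcases n with _ | n
      · simp
      · rw [Nat.add_sub_cancel, pow_succ, mul_assoc]
    rw [h1]
    linear_combination (-x n) * h2
  have he0 : ∀ n : ℕ, 0 ≤ (n : ℝ) * x n * r ^ (n - 1) := fun n =>
    mul_nonneg (mul_nonneg (by positivity) (hx0 _)) (pow_nonneg hr0 _)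
  have hc0 : ∀ n : ℕ, 0 ≤ ∑ j ∈ Finset.range (n + 1), A j * B (n - j) := fun n =>
    Finset.sum_nonneg fun j _ => mul_nonneg (hA0 _) (hB0 _)
  have hHh : H * h ≤ C := (mul_le_of_le_one_right hH0 hh1).trans hHC
  constructor
  · intro N
    rw [Finset.sum_congr rfl fun n _ => hterm n, Finset.sum_sub_distrib, ← Finset.sum_mul]
    have h1 := sum_le_hasSum (Finset.range N) (fun n _ => hc0 n) hconv
    have h2 := sum_le_hasSum (Finset.range N) (fun n _ => he0 n) hshift
    have h3 := Finset.sum_nonneg fun n (_ : n ∈ Finset.range N) => hc0 n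
    have h4 := Finset.sum_nonneg fun n (_ : n ∈ Finset.range N) => he0 n
    have h5 := mul_le_mul_of_nonneg_right h2 hh0
    have h6 := mul_nonneg h4 hh0
    rw [abs_le]
    constructor <;> linarith
  · have h1 := (hconv.sub (hshift.mul_right h)).tendsto_sum_nat
    rw [sub_self] at h1
    exact h1.congr fun N => Finset.sum_congr rfl fun n _ => (hterm n).symm

theorem absolutelyContinuousOnInterval_const (c a b : ℝ) :
    AbsolutelyContinuousOnInterval (fun _ => c) a b :=
  contDiffOn_const.absolutelyContinuousOnInterval

theorem AbsolutelyContinuousOnInterval.fun_pow {f : ℝ → ℝ} {a b : ℝ}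
    (hf : AbsolutelyContinuousOnInterval f a b) (n : ℕ) :
    AbsolutelyContinuousOnInterval (fun u => f u ^ n) a b := by
  induction n with
  | zero => simpa using absolutelyContinuousOnInterval_const 1 a b
  | succ n ih => simpa only [pow_succ] using ih.fun_mul hf

theorem AbsolutelyContinuousOnInterval.fun_finsetSum {ι : Type*} {f : ι → ℝ → ℝ} {a b : ℝ}
    (s : Finset ι) (hf : ∀ i ∈ s, AbsolutelyContinuousOnInterval (f i) a b) :
    AbsolutelyContinuousOnInterval (fun u => ∑ i ∈ s, f i u) a b := by
  classical
  induction s using Finset.induction_on with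
  | empty => simpa using absolutelyContinuousOnInterval_const 0 a b
  | insert i s hi ih =>
    simp only [Finset.sum_insert hi]
    exact (hf i (Finset.mem_insert_self i s)).fun_add
      (ih fun j hj => hf j (Finset.mem_insert_of_mem hj))

/-- The generating function of a solution of the forward equation is constant along the
characteristic curves. -/
theorem hasSum_characteristic {rate : ℝ → ℝ} {p : ℝ → ℕ → ℝ} {π : ℕ → ℝ → ℝ} {r : ℝ → ℝ}
    {T ρ : ℝ} (hp : IsReproductionLaw p) (hT : 0 ≤ T) (hrate : IntervalIntegrable rate volume 0 T)
    (hπ0 : ∀ n, ∀ t ∈ Icc 0 T, 0 ≤ π n t) (hπ1 : ∀ n, ∀ t ∈ Icc 0 T, π n t ≤ 1)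
    (hint : ∀ n, IntervalIntegrable (forwardRate rate p π n) volume 0 T)
    (hfwd : ∀ n, ∀ t ∈ Icc 0 T, π n t = (if n = 1 then 1 else 0) +
      ∫ u in 0..t, forwardRate rate p π n u)
    (hr : AbsolutelyContinuousOnInterval r 0 T) (hr0 : ∀ t ∈ Icc 0 T, 0 ≤ r t)
    (hrρ : ∀ t ∈ Icc 0 T, r t ≤ ρ) (hρ : ρ < 1)
    (hrd : ∀ᵐ u, u ∈ uIcc 0 T → HasDerivAt r (rate u * (r u - ∑' k, p u k * r u ^ k)) u) :
    HasSum (fun n => π n T * r T ^ n) (r 0) := by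
  -- `π'` agrees with `π` on [0, T], but as an indefinite integral it is absolutely continuous and
  -- has a two-sided derivative almost everywhere.
  set π' : ℕ → ℝ → ℝ := fun n t => (if n = 1 then 1 else 0) +
    ∫ u in 0..t, forwardRate rate p π n u with hπ'
  set G : ℕ → ℝ → ℝ := fun N u => ∑ n ∈ Finset.range N, π' n u * r u ^ n with hG
  have hGac : ∀ N, AbsolutelyContinuousOnInterval (G N) 0 T := fun N =>
    AbsolutelyContinuousOnInterval.fun_finsetSum _ fun n _ =>
      ((absolutelyContinuousOnInterval_const _ 0 T).fun_add
        ((hint n).absolutelyContinuousOnInterval_intervalIntegral left_mem_uIcc)).fun_mul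
        (hr.fun_pow n)
  have hGd : ∀ N, ∀ᵐ u, u ∈ uIoc 0 T → deriv (G N) u = rate u * ∑ n ∈ Finset.range N,
      ((∑ j ∈ Finset.range (n + 1), (j + 1) * π (j + 1) u * p u (n - j) - n * π n u) * r u ^ n +
        π n u * (n * r u ^ (n - 1) * (r u - ∑' k, p u k * r u ^ k))) := by
    intro N
    have hπd : ∀ᵐ u, ∀ n, u ∈ uIcc 0 T → ∀ c ∈ uIcc 0 T,
        HasDerivAt (fun t => ∫ u in c..t, forwardRate rate p π n u)
          (forwardRate rate p π n u) u :=
      ae_all_iff.2 fun n => (hint n).ae_hasDerivAt_integral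
    filter_upwards [hrd, hπd] with u hu1 hu2 hu
    have hu' := uIoc_subset_uIcc hu
    have huI : u ∈ Icc 0 T := by rwa [uIcc_of_le hT] at hu'
    have hd : HasDerivAt (G N) (∑ n ∈ Finset.range N, (forwardRate rate p π n u * r u ^ n +
        π' n u * (n * r u ^ (n - 1) * (rate u * (r u - ∑' k, p u k * r u ^ k))))) u :=
      HasDerivAt.fun_sum fun n _ =>
        ((hu2 n hu' 0 left_mem_uIcc).const_add _).mul ((hu1 hu').fun_pow n)
    rw [hd.deriv, Finset.mul_sum]
    refine Finset.sum_congr rfl fun n _ => ?_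
    rw [show π' n u = π n u from (hfwd n u huI).symm, forwardRate]
    ring
  -- The bound `r ≤ ρ < 1` makes the domination |λ| Σ (j+1) ρ^j uniform in `N`.
  have hlim : Tendsto (fun N => ∫ u in 0..T, deriv (G N) u) atTop (𝓝 (∫ _ in 0..T, (0 : ℝ))) := by
    have hprop : ∀ u ∈ uIoc 0 T, _ := fun u hu =>
      have huI : u ∈ Icc 0 T := by simpa only [uIcc_of_le hT] using uIoc_subset_uIcc hu
      characteristic_partialSum (x := fun n => π n u) (q := p u) (r := r u) (ρ := ρ)
        (fun n => hπ0 n u huI) (fun n => hπ1 n u huI) (hp.nonneg u huI.1) (hp.hasSum_one u huI.1)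
        (hr0 u huI) (hrρ u huI) hρ
    refine intervalIntegral.tendsto_integral_filter_of_dominated_convergence
      (fun u => |rate u| * ∑' j : ℕ, ((j : ℝ) + 1) * ρ ^ j)
      (Eventually.of_forall fun N =>
        (hGac N).intervalIntegrable_deriv.def'.aestronglyMeasurable)
      (Eventually.of_forall fun N => ?_) (hrate.abs.mul_const _) ?_
    · filter_upwards [hGd N] with u hu huI
      rw [hu huI, Real.norm_eq_abs, abs_mul]
      exact mul_le_mul_of_nonneg_left ((hprop u huI).1 N) (abs_nonneg _)
    · filter_upwards [ae_all_iff.2 hGd] with u hu huI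
      simp only [hu _ huI]
      simpa using (hprop u huI).2.const_mul (rate u)
  simp only [(hGac _).integral_deriv_eq_sub, intervalIntegral.integral_zero] at hlim
  have hG0 : ∀ N ≥ 2, G N 0 = r 0 := fun N hN => by
    simp only [hG, hπ', intervalIntegral.integral_same, add_zero]
    rw [Finset.sum_eq_single 1]
    · simp
    · intro n _ hn
      simp [hn]
    · intro h
      exact absurd (Finset.mem_range.2 hN) h
  have hGT : ∀ N, G N T = ∑ n ∈ Finset.range N, π n T * r T ^ n := fun N => by
    simp only [hG, hπ', ← hfwd _ T ⟨hT, le_rfl⟩]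
  rw [hasSum_iff_tendsto_nat_of_nonneg fun n =>
    mul_nonneg (hπ0 n T ⟨hT, le_rfl⟩) (pow_nonneg (hr0 T ⟨hT, le_rfl⟩) _)]
  have h := hlim.add_const (r 0)
  rw [zero_add] at h
  refine h.congr' ?_
  filter_upwards [eventually_ge_atTop 2] with N hN
  rw [hG0 N hN, hGT, sub_add_cancel]

/-- A C¹ function is Lipschitz on a compact interval, and Lipschitz maps preserve absolute
continuity. The `K + 1` in the proof avoids division by zero. -/
theorem AbsolutelyContinuousOnInterval.contDiffOn_comp {f φ : ℝ → ℝ} {a b c d : ℝ}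
    (hf : AbsolutelyContinuousOnInterval f a b) (hφ : ContDiffOn ℝ 1 φ (Icc c d))
    (hmaps : MapsTo f (uIcc a b) (Icc c d)) :
    AbsolutelyContinuousOnInterval (fun u => φ (f u)) a b := by
  obtain ⟨K, hK⟩ := hφ.exists_lipschitzOnWith (by decide) (convex_Icc _ _) isCompact_Icc
  rw [absolutelyContinuousOnInterval_iff] at hf ⊢
  intro ε hε
  obtain ⟨δ, hδ, h⟩ := hf (ε / (K + 1)) (by positivity)
  refine ⟨δ, hδ, fun E hE hEδ => ?_⟩
  have hle : ∑ i ∈ Finset.range E.1, dist (φ (f (E.2 i).1)) (φ (f (E.2 i).2)) ≤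
      K * ∑ i ∈ Finset.range E.1, dist (f (E.2 i).1) (f (E.2 i).2) := by
    rw [Finset.mul_sum]
    exact Finset.sum_le_sum fun i hi =>
      hK.dist_le_mul _ (hmaps (hE.1 i hi).1) _ (hmaps (hE.1 i hi).2)
  have hlt := h E hE hEδ
  have h0 : 0 ≤ ∑ i ∈ Finset.range E.1, dist (f (E.2 i).1) (f (E.2 i).2) :=
    Finset.sum_nonneg fun _ _ => dist_nonneg
  rw [lt_div_iff₀ (by positivity)] at hlt
  linarith

theorem AbsolutelyContinuousOnInterval.exp {f : ℝ → ℝ} {a b : ℝ}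
    (hf : AbsolutelyContinuousOnInterval f a b) :
    AbsolutelyContinuousOnInterval (fun u => Real.exp (f u)) a b := by
  obtain ⟨C, hC⟩ := hf.exists_bound
  exact hf.contDiffOn_comp (c := -C) (d := C) Real.contDiff_exp.contDiffOn
    fun u hu => abs_le.1 (hC u hu)

theorem AbsolutelyContinuousOnInterval.rpow_const {f : ℝ → ℝ} {a b δ : ℝ}
    (hf : AbsolutelyContinuousOnInterval f a b) (hδ : 0 < δ) (hfδ : ∀ u ∈ uIcc a b, δ ≤ f u)
    (α : ℝ) : AbsolutelyContinuousOnInterval (fun u => f u ^ α) a b := by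
  obtain ⟨C, hC⟩ := hf.exists_bound
  refine hf.contDiffOn_comp (φ := fun y => y ^ α) (c := δ) (d := C) ?_
    fun u hu => ⟨hfδ u hu, (abs_le.1 (hC u hu)).2⟩
  exact contDiffOn_id.rpow_const_of_ne fun y hy => (hδ.trans_le hy.1).ne'

/-! ### The theta-positive environment and its characteristics -/

/-- The growth exponent `∫₀ᵗ (a_u - 1) λ_u du` of the mean population size. -/
noncomputable def growthExponent (rate a : ℝ → ℝ) (t : ℝ) : ℝ :=
  ∫ u in (0 : ℝ)..t, (a u - 1) * rate u

/-- The integral `θ (1 + θ)⁻¹ ∫₀ᵗ a_u λ_u μ_u^(-θ) du`. -/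
noncomputable def thetaVariation (θ : ℝ) (rate a : ℝ → ℝ) (t : ℝ) : ℝ :=
  ∫ u in (0 : ℝ)..t, θ / (1 + θ) * (a u * rate u * Real.exp (-θ * growthExponent rate a u))

/-- The assumptions on the varying environment of a theta-positive branching process. -/
structure IsThetaEnvironment (θ : ℝ) (rate a : ℝ → ℝ) : Prop where
  theta_pos : 0 < θ
  rate_nonneg : ∀ t, 0 ≤ t → 0 ≤ rate t
  rate_integrable : ∀ t, 0 ≤ t → IntervalIntegrable rate volume 0 t
  a_measurable : Measurable a
  a_nonneg : ∀ t, 0 ≤ t → 0 ≤ a t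
  a_le : ∀ t, 0 ≤ t → a t ≤ 1 + 1 / θ

namespace IsThetaEnvironment

variable {θ : ℝ} {rate a : ℝ → ℝ} {T : ℝ}

theorem intervalIntegrable_mul (h : IsThetaEnvironment θ rate a) (hT : 0 ≤ T) :
    IntervalIntegrable (fun u => a u * rate u) volume 0 T := by
  rw [intervalIntegrable_iff_integrableOn_Ioc_of_le hT]
  have hrate := (intervalIntegrable_iff_integrableOn_Ioc_of_le hT).1 (h.rate_integrable T hT)
  refine Integrable.bdd_mul (c := 1 + 1 / θ) hrate h.a_measurable.aestronglyMeasurable ?_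
  filter_upwards [ae_restrict_mem measurableSet_Ioc] with u hu
  rw [Real.norm_eq_abs, abs_of_nonneg (h.a_nonneg u hu.1.le)]
  exact h.a_le u hu.1.le

theorem intervalIntegrable_growth (h : IsThetaEnvironment θ rate a) (hT : 0 ≤ T) :
    IntervalIntegrable (fun u => (a u - 1) * rate u) volume 0 T := by
  simpa only [sub_mul, one_mul] using (h.intervalIntegrable_mul hT).sub (h.rate_integrable T hT)

theorem growthExponent_ac (h : IsThetaEnvironment θ rate a) (hT : 0 ≤ T) :
    AbsolutelyContinuousOnInterval (growthExponent rate a) 0 T :=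
  (h.intervalIntegrable_growth hT).absolutelyContinuousOnInterval_intervalIntegral left_mem_uIcc

theorem intervalIntegrable_variation (h : IsThetaEnvironment θ rate a) (hT : 0 ≤ T) :
    IntervalIntegrable
      (fun u => θ / (1 + θ) * (a u * rate u * Real.exp (-θ * growthExponent rate a u)))
      volume 0 T :=
  ((h.intervalIntegrable_mul hT).mul_continuousOn
    ((h.growthExponent_ac hT).const_mul (-θ)).exp.continuousOn).const_mul _

theorem thetaVariation_ac (h : IsThetaEnvironment θ rate a) (hT : 0 ≤ T) :
    AbsolutelyContinuousOnInterval (thetaVariation θ rate a) 0 T :=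
  (h.intervalIntegrable_variation hT).absolutelyContinuousOnInterval_intervalIntegral left_mem_uIcc

theorem ae_hasDerivAt_growthExponent (h : IsThetaEnvironment θ rate a) (hT : 0 ≤ T) :
    ∀ᵐ u, u ∈ uIcc 0 T → HasDerivAt (growthExponent rate a) ((a u - 1) * rate u) u := by
  filter_upwards [(h.intervalIntegrable_growth hT).ae_hasDerivAt_integral] with u hu huI
  exact hu huI 0 left_mem_uIcc

theorem ae_hasDerivAt_thetaVariation (h : IsThetaEnvironment θ rate a) (hT : 0 ≤ T) :
    ∀ᵐ u, u ∈ uIcc 0 T → HasDerivAt (thetaVariation θ rate a)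
      (θ / (1 + θ) * (a u * rate u * Real.exp (-θ * growthExponent rate a u))) u := by
  filter_upwards [(h.intervalIntegrable_variation hT).ae_hasDerivAt_integral] with u hu huI
  exact hu huI 0 left_mem_uIcc

/-- Almost everywhere, μ^(-θ) + B has derivative μ^(-θ) λ θ (1 + θ - aθ)/(1 + θ), nonnegative
precisely because a ≤ 1 + 1/θ. This monotonicity keeps the characteristics inside [0, 1]. -/
theorem exp_add_thetaVariation_le (h : IsThetaEnvironment θ rate a) (hT : 0 ≤ T) {u : ℝ}
    (hu : u ∈ Icc 0 T) :
    Real.exp (-θ * growthExponent rate a u) + thetaVariation θ rate a u ≤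
      Real.exp (-θ * growthExponent rate a T) + thetaVariation θ rate a T := by
  have hθ := h.theta_pos
  have hac := (((h.growthExponent_ac hT).const_mul (-θ)).exp.fun_add (h.thetaVariation_ac hT)).mono
    (c := u) (d := T) (uIcc_subset_uIcc (by rwa [uIcc_of_le hT]) right_mem_uIcc)
  rw [← sub_nonneg, ← hac.integral_deriv_eq_sub]
  refine intervalIntegral.integral_nonneg_of_ae_restrict hu.2 ?_
  filter_upwards [ae_restrict_mem measurableSet_Icc,
    ae_restrict_of_ae (h.ae_hasDerivAt_growthExponent hT),
    ae_restrict_of_ae (h.ae_hasDerivAt_thetaVariation hT)] with v hv h1 h2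
  have hv0 : 0 ≤ v := hu.1.trans hv.1
  have hvI : v ∈ uIcc 0 T := by
    rw [uIcc_of_le hT]
    exact ⟨hv0, hv.2⟩
  have hd := ((h1 hvI).const_mul (-θ)).exp.fun_add (h2 hvI)
  rw [Pi.zero_apply, hd.deriv]
  have ha : a v * θ ≤ 1 + θ := by
    have := mul_le_mul_of_nonneg_right (h.a_le v hv0) hθ.le
    rwa [add_mul, one_mul, one_div, inv_mul_cancel₀ hθ.ne', add_comm] at this
  have he : Real.exp (-θ * growthExponent rate a v) * (-θ * ((a v - 1) * rate v)) +
      θ / (1 + θ) * (a v * rate v * Real.exp (-θ * growthExponent rate a v)) =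
      Real.exp (-θ * growthExponent rate a v) * rate v * θ * ((1 + θ - a v * θ) / (1 + θ)) := by
    field_simp
    ring
  rw [he]
  have := h.rate_nonneg v hv0
  have : 0 ≤ (1 + θ - a v * θ) / (1 + θ) := div_nonneg (by linarith) (by linarith)
  positivity

theorem thetaVariation_nonneg (h : IsThetaEnvironment θ rate a) (hT : 0 ≤ T) :
    0 ≤ thetaVariation θ rate a T := by
  refine intervalIntegral.integral_nonneg hT fun u hu => ?_
  have h1 := h.rate_nonneg u hu.1
  have h2 := h.a_nonneg u hu.1
  have h3 := h.theta_pos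
  positivity

/-- The characteristic curve of the forward equation which takes the value `1 - s` at time `T`
when `K = B_T + (1 - s)^(-θ) μ_T^(-θ)`. -/
theorem characteristic_hasDerivAt (h : IsThetaEnvironment θ rate a) (hT : 0 ≤ T)
    {p : ℝ → ℕ → ℝ} {K : ℝ}
    (hpgf : ∀ t, 0 ≤ t → ∀ s ∈ Icc (0 : ℝ) 1,
      HasSum (fun k => p t k * s ^ k) (thetaPGF θ (a t) s))
    (hK : ∀ u ∈ Icc 0 T, thetaVariation θ rate a u < K)
    (hx1 : ∀ u ∈ Icc 0 T, Real.exp (-growthExponent rate a u) *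
      (K - thetaVariation θ rate a u) ^ (-1 / θ) ≤ 1) :
    ∀ᵐ u, u ∈ uIcc 0 T → HasDerivAt
      (fun v => 1 - Real.exp (-growthExponent rate a v) *
        (K - thetaVariation θ rate a v) ^ (-1 / θ))
      (rate u * ((1 - Real.exp (-growthExponent rate a u) *
        (K - thetaVariation θ rate a u) ^ (-1 / θ)) -
        ∑' k, p u k * (1 - Real.exp (-growthExponent rate a u) *
        (K - thetaVariation θ rate a u) ^ (-1 / θ)) ^ k)) u := by
  have hθ := h.theta_pos
  filter_upwards [h.ae_hasDerivAt_growthExponent hT, h.ae_hasDerivAt_thetaVariation hT]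
    with u h1 h2 hu
  have huI : u ∈ Icc 0 T := by rwa [uIcc_of_le hT] at hu
  set y := K - thetaVariation θ rate a u with hy
  have hy0 : 0 < y := sub_pos.2 (hK u huI)
  set x := Real.exp (-growthExponent rate a u) * y ^ (-1 / θ) with hx
  have hx0 : 0 < x := mul_pos (Real.exp_pos _) (Real.rpow_pos_of_pos hy0 _)
  have hsum := (hpgf u huI.1 (1 - x) ⟨by linarith [hx1 u huI], by linarith⟩).tsum_eq
  rw [hsum, thetaPGF, sub_sub_cancel, Real.rpow_add hx0, Real.rpow_one]
  -- The Bernoulli substitution: x^(-θ) is μ^θ (K - B), so the nonlinear term of h becomes explicit.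
  have hxθ : x ^ θ = Real.exp (-θ * growthExponent rate a u) * y⁻¹ := by
    rw [hx, Real.mul_rpow (Real.exp_pos _).le (Real.rpow_nonneg hy0.le _), ← Real.exp_mul,
      ← Real.rpow_mul hy0.le, div_mul_cancel₀ _ hθ.ne', Real.rpow_neg_one]
    congr 2
    ring
  rw [hxθ]
  have hd := (((h1 hu).fun_neg.exp).mul (((h2 hu).const_sub K).rpow_const (p := -1 / θ)
    (Or.inl hy0.ne'))).const_sub 1
  refine hd.congr_deriv ?_
  rw [← hy, Real.rpow_sub_one hy0.ne', hx]
  field_simp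
  ring

end IsThetaEnvironment

/-! ### Generating function, mean and extinction probability -/

theorem pointProb_nonneg {Ω : Type*} [MeasurableSpace Ω] (P : Measure Ω) (Z : ℝ≥0 → Ω → ℕ) (n : ℕ)
    (u : ℝ) : 0 ≤ pointProb P Z n u :=
  measureReal_nonneg

section ThetaPositive

variable {Ω : Type*} [mΩ : MeasurableSpace Ω] {P : Measure Ω} [IsProbabilityMeasure P]
  {ℱ : Filtration ℝ≥0 mΩ} {θ : ℝ} {rate a : ℝ → ℝ} {p : ℝ → ℕ → ℝ} {Z : ℝ≥0 → Ω → ℕ}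

/-- The explicit generating function of a theta-positive branching process. -/
theorem hasSum_pointProb_mul_pow (h : IsThetaEnvironment θ rate a) (hp : IsReproductionLaw p)
    (hpgf : ∀ t, 0 ≤ t → ∀ s ∈ Icc (0 : ℝ) 1,
      HasSum (fun k => p t k * s ^ k) (thetaPGF θ (a t) s))
    (hZ : IsMarkovBranchingProcess rate p ℱ P Z) {T : ℝ} (hT : 0 ≤ T) {s : ℝ} (hs0 : 0 ≤ s)
    (hs1 : s < 1) :
    HasSum (fun n => pointProb P Z n T * s ^ n)
      (1 - (thetaVariation θ rate a T +
        (1 - s) ^ (-θ) * Real.exp (-θ * growthExponent rate a T)) ^ (-1 / θ)) := by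
  have hθ := h.theta_pos
  have hθ' : -1 / θ ≤ 0 := div_nonpos_of_nonpos_of_nonneg (by norm_num) hθ.le
  have hs : 0 < 1 - s := by linarith
  -- This `K` makes the characteristic end at `r T = s`.
  set K := thetaVariation θ rate a T +
    (1 - s) ^ (-θ) * Real.exp (-θ * growthExponent rate a T) with hKdef
  have hκ : 1 ≤ (1 - s) ^ (-θ) :=
    Real.one_le_rpow_of_pos_of_le_one_of_nonpos hs (by linarith) (by linarith)
  have hKB : ∀ u ∈ Icc 0 T,
      Real.exp (-θ * growthExponent rate a u) ≤ K - thetaVariation θ rate a u := fun u hu => by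
    have h1 := h.exp_add_thetaVariation_le hT hu
    have h2 := le_mul_of_one_le_left (Real.exp_pos (-θ * growthExponent rate a T)).le hκ
    linarith
  have hK0 : ∀ u ∈ Icc 0 T, 0 < K - thetaVariation θ rate a u := fun u hu =>
    (Real.exp_pos _).trans_le (hKB u hu)
  have hexp : ∀ g : ℝ, Real.exp (-θ * g) ^ (-1 / θ) = Real.exp g := fun g => by
    rw [← Real.exp_mul]
    congr 1
    field_simp
  set x : ℝ → ℝ := fun u => Real.exp (-growthExponent rate a u) *
    (K - thetaVariation θ rate a u) ^ (-1 / θ) with hx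
  have hx1 : ∀ u ∈ Icc 0 T, x u ≤ 1 := fun u hu => by
    have h1 := Real.rpow_le_rpow_of_nonpos (Real.exp_pos _) (hKB u hu) hθ'
    rw [hexp] at h1
    calc x u ≤ Real.exp (-growthExponent rate a u) * Real.exp (growthExponent rate a u) :=
          mul_le_mul_of_nonneg_left h1 (Real.exp_pos _).le
      _ = 1 := by rw [← Real.exp_add, neg_add_cancel, Real.exp_zero]
  -- A bound on |g| keeps `K - B` away from 0, so that its power is absolutely continuous, and keeps
  -- `x` away from 0, which supplies `ρ < 1`.
  obtain ⟨C, hC⟩ := (h.growthExponent_ac hT).exists_bound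
  rw [uIcc_of_le hT] at hC
  have hδ : ∀ u ∈ Icc 0 T, Real.exp (-θ * C) ≤ K - thetaVariation θ rate a u := fun u hu => by
    refine le_trans (Real.exp_le_exp.2 ?_) (hKB u hu)
    have := (abs_le.1 (hC u hu)).2
    nlinarith
  have hxac : AbsolutelyContinuousOnInterval x 0 T := by
    refine ((h.growthExponent_ac hT).fun_neg.exp).fun_mul
      (((absolutelyContinuousOnInterval_const K 0 T).fun_sub (h.thetaVariation_ac hT)).rpow_const
        (Real.exp_pos (-θ * C)) ?_ _)
    rwa [uIcc_of_le hT]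
  have hK00 : 0 < K := by
    have := hK0 T ⟨hT, le_rfl⟩
    have := h.thetaVariation_nonneg hT
    linarith
  have hxδ : ∀ u ∈ Icc 0 T, Real.exp (-C) * K ^ (-1 / θ) ≤ x u := fun u hu => by
    refine mul_le_mul (Real.exp_le_exp.2 (neg_le_neg (abs_le.1 (hC u hu)).2)) ?_
      (Real.rpow_nonneg hK00.le _) (Real.exp_pos _).le
    refine Real.rpow_le_rpow_of_nonpos (hK0 u hu) ?_ hθ'
    have := h.thetaVariation_nonneg hu.1
    linarith
  obtain ⟨c, hc⟩ := exists_thetaPGF_coeff hpgf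
  have hpm : ∀ t k, AEStronglyMeasurable (fun u => p u k) (volume.restrict (Ioc 0 t)) := by
    intro t k
    refine AEStronglyMeasurable.congr (f := fun u => (if k = 0 then 1 else 0) + a u * c k)
      (measurable_const.add (h.a_measurable.mul_const _)).aestronglyMeasurable ?_
    filter_upwards [ae_restrict_mem measurableSet_Ioc] with u hu
    exact (hc u hu.1.le k).symm
  have hrate : ∀ t, 0 ≤ t → IntegrableOn rate (Ioc 0 t) := fun t ht =>
    (intervalIntegrable_iff_integrableOn_Ioc_of_le ht).1 (h.rate_integrable t ht)
  have key := hasSum_characteristic (r := fun u => 1 - x u)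
    (ρ := 1 - Real.exp (-C) * K ^ (-1 / θ)) hp hT (h.rate_integrable T hT)
    (fun n t _ => pointProb_nonneg P Z n t)
    (fun n t _ => measureReal_le_one)
    (fun n => (intervalIntegrable_iff_integrableOn_Ioc_of_le hT).2
      (hZ.integrableOn_forwardRate hp (hrate T hT) (hpm T) n))
    (fun n t ht => hZ.forward_equation hp ht.1 (hrate t ht.1) (hpm t) n)
    ((absolutelyContinuousOnInterval_const 1 0 T).fun_sub hxac)
    (fun t ht => by linarith [hx1 t ht])
    (fun t ht => by linarith [hxδ t ht])
    (by linarith [mul_pos (Real.exp_pos (-C)) (Real.rpow_pos_of_pos hK00 (-1 / θ))])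
    (h.characteristic_hasDerivAt hT hpgf (fun u hu => sub_pos.1 (hK0 u hu)) hx1)
  have hx0 : x 0 = K ^ (-1 / θ) := by
    simp [hx, growthExponent, thetaVariation]
  have hxT : x T = 1 - s := by
    rw [hx]
    dsimp only
    rw [hKdef, add_sub_cancel_left, Real.mul_rpow (Real.rpow_nonneg hs.le _) (Real.exp_pos _).le,
      hexp, ← Real.rpow_mul hs.le, mul_div_assoc', neg_mul_neg, mul_one, div_self hθ.ne',
      Real.rpow_one, mul_left_comm, ← Real.exp_add, neg_add_cancel, Real.exp_zero, mul_one]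
  simpa only [hx0, hxT, sub_sub_cancel] using key

theorem lintegral_comp_eq_tsum {T : ℝ} (hZ : ∀ t, Measurable (Z t)) (f : ℕ → ℝ≥0∞) :
    ∫⁻ ω, f (Z T.toNNReal ω) ∂P = ∑' n, f n * ENNReal.ofReal (pointProb P Z n T) := by
  rw [← lintegral_map (measurable_of_countable f) (hZ _), lintegral_countable']
  refine tsum_congr fun n => ?_
  rw [Measure.map_apply (hZ _) (measurableSet_singleton n), pointProb, ofReal_measureReal]
  rfl

theorem hasSum_pointProb (hZ : ∀ t, Measurable (Z t)) (T : ℝ) :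
    HasSum (fun n => pointProb P Z n T) 1 := by
  have h := lintegral_comp_eq_tsum (P := P) (T := T) hZ fun _ => 1
  simp only [lintegral_const, measure_univ, one_mul] at h
  have h1 := ENNReal.hasSum_toReal (f := fun n => ENNReal.ofReal (pointProb P Z n T)) (by
    rw [← h]; exact ENNReal.one_ne_top)
  rw [← ENNReal.tsum_toReal_eq fun _ => ENNReal.ofReal_ne_top, ← h] at h1
  simpa only [ENNReal.toReal_ofReal (pointProb_nonneg P Z _ T), ENNReal.toReal_one] using h1

/-- The mean population size of a theta-positive branching process. -/
theorem meanSize_thetaPositive (h : IsThetaEnvironment θ rate a) (hp : IsReproductionLaw p)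
    (hpgf : ∀ t, 0 ≤ t → ∀ s ∈ Icc (0 : ℝ) 1,
      HasSum (fun k => p t k * s ^ k) (thetaPGF θ (a t) s))
    (hZ : IsMarkovBranchingProcess rate p ℱ P Z) (t : ℝ≥0) :
    meanSize P Z t = ENNReal.ofReal (Real.exp (growthExponent rate a t)) := by
  have hθ := h.theta_pos
  set B := thetaVariation θ rate a t
  set g := growthExponent rate a t
  have hB : 0 ≤ B := h.thetaVariation_nonneg t.coe_nonneg
  -- Take s = 1 - w_j, increasing to 1. The quotient (1 - s^Z)/(1 - s) = Σ_{i<Z} s^i increases to Z,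
  -- so monotone convergence gives the mean without assuming it finite.
  set w : ℕ → ℝ := fun j => 1 / ((j : ℝ) + 1) with hw
  have hw0 : ∀ j, 0 < w j := fun j => by positivity
  have hw1 : ∀ j, w j ≤ 1 := fun j => by
    rw [hw, div_le_one (by positivity)]
    linarith [(Nat.cast_nonneg j : (0 : ℝ) ≤ j)]
  have hwlim : Tendsto w atTop (𝓝 0) := tendsto_one_div_add_atTop_nhds_zero_nat
  have hexp : ∀ y : ℝ, Real.exp (-θ * y) ^ (-1 / θ) = Real.exp y := fun y => by
    rw [← Real.exp_mul]
    congr 1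
    field_simp
  have hval : ∀ j, ∫⁻ ω, ENNReal.ofReal (∑ i ∈ Finset.range (Z t ω), (1 - w j) ^ i) ∂P =
      ENNReal.ofReal ((w j ^ θ * B + Real.exp (-θ * g)) ^ (-1 / θ)) := by
    intro j
    have h1 := lintegral_comp_eq_tsum (P := P) (T := t) hZ.measurable
      fun n => ENNReal.ofReal (∑ i ∈ Finset.range n, (1 - w j) ^ i)
    rw [Real.toNNReal_coe] at h1
    have hs0 : 0 ≤ 1 - w j := by linarith [hw1 j]
    have hnn : ∀ n, 0 ≤ ∑ i ∈ Finset.range n, (1 - w j) ^ i := fun n =>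
      Finset.sum_nonneg fun i _ => pow_nonneg hs0 i
    have h2 := ((hasSum_pointProb (P := P) hZ.measurable t).sub
      (hasSum_pointProb_mul_pow h hp hpgf hZ t.coe_nonneg hs0
        (by linarith [hw0 j] : 1 - w j < 1))).mul_right (w j)⁻¹
    simp only [sub_sub_cancel] at h2
    have h3 : ∀ n, (∑ i ∈ Finset.range n, (1 - w j) ^ i) * pointProb P Z n t =
        (pointProb P Z n t - pointProb P Z n t * (1 - w j) ^ n) * (w j)⁻¹ := fun n => by
      have h4 := geom_sum_mul (1 - w j) n
      have h5 : w j ≠ 0 := (hw0 j).ne'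
      field_simp
      linear_combination (-pointProb P Z n t) * h4
    -- Pulling w^(-θ) out of the power produces a factor w, which cancels w⁻¹ and removes the
    -- singularity at w = 0.
    have h6 : (B + w j ^ (-θ) * Real.exp (-θ * g)) ^ (-1 / θ) * (w j)⁻¹ =
        (w j ^ θ * B + Real.exp (-θ * g)) ^ (-1 / θ) := by
      have h7 : B + w j ^ (-θ) * Real.exp (-θ * g) =
          w j ^ (-θ) * (w j ^ θ * B + Real.exp (-θ * g)) := by
        rw [mul_add, ← mul_assoc, ← Real.rpow_add (hw0 j), neg_add_cancel, Real.rpow_zero, one_mul]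
      have h8 : w j ^ (-θ * (-1 / θ)) = w j := by
        rw [mul_div_assoc', neg_mul_neg, mul_one, div_self hθ.ne', Real.rpow_one]
      rw [h7, Real.mul_rpow (Real.rpow_nonneg (hw0 j).le _), ← Real.rpow_mul (hw0 j).le, h8,
        mul_right_comm, mul_inv_cancel₀ (hw0 j).ne', one_mul]
      exact add_nonneg (mul_nonneg (Real.rpow_nonneg (hw0 j).le _) hB) (Real.exp_pos _).le
    rw [h1, ← h6]
    simp only [← ENNReal.ofReal_mul (hnn _), h3]
    refine Eq.trans ?_ (congrArg ENNReal.ofReal h2.tsum_eq)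
    refine (ENNReal.ofReal_tsum_of_nonneg (fun n => ?_) h2.summable).symm
    rw [← h3]
    exact mul_nonneg (hnn n) (pointProb_nonneg P Z n t)
  have hmct : Tendsto
      (fun j => ∫⁻ ω, ENNReal.ofReal (∑ i ∈ Finset.range (Z t ω), (1 - w j) ^ i) ∂P) atTop
      (𝓝 (∫⁻ ω, (Z t ω : ℝ≥0∞) ∂P)) := by
    refine lintegral_tendsto_of_tendsto_of_monotone (fun j => ?_) (ae_of_all _ fun ω => ?_)
      (ae_of_all _ fun ω => ?_)
    · exact ((measurable_of_countable fun n : ℕ =>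
        ENNReal.ofReal (∑ i ∈ Finset.range n, (1 - w j) ^ i)).comp (hZ.measurable t)).aemeasurable
    · intro j k hjk
      refine ENNReal.ofReal_le_ofReal (Finset.sum_le_sum fun i _ => ?_)
      refine pow_le_pow_left₀ (by linarith [hw1 j]) (sub_le_sub_left ?_ _) i
      exact one_div_le_one_div_of_le (by positivity) (by gcongr)
    · have h1 : Tendsto (fun j => ∑ i ∈ Finset.range (Z t ω), (1 - w j) ^ i) atTop
          (𝓝 (∑ i ∈ Finset.range (Z t ω), (1 - 0) ^ i)) :=
        tendsto_finsetSum _ fun i _ => (hwlim.const_sub 1).pow i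
      simpa using ENNReal.tendsto_ofReal h1
  refine tendsto_nhds_unique hmct ?_
  simp only [hval]
  refine ENNReal.tendsto_ofReal ?_
  rw [← hexp g]
  have h1 : Tendsto (fun j => w j ^ θ * B + Real.exp (-θ * g)) atTop
      (𝓝 (0 ^ θ * B + Real.exp (-θ * g))) :=
    ((hwlim.rpow_const (Or.inr hθ.le)).mul_const B).add_const _
  rw [Real.zero_rpow hθ.ne', zero_mul, zero_add] at h1
  exact h1.rpow_const (Or.inl (Real.exp_pos _).ne')

/-- The extinction probability up to time `t` of a theta-positive branching process. -/
theorem measure_extinct_thetaPositive (h : IsThetaEnvironment θ rate a) (hp : IsReproductionLaw p)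
    (hpgf : ∀ t, 0 ≤ t → ∀ s ∈ Icc (0 : ℝ) 1,
      HasSum (fun k => p t k * s ^ k) (thetaPGF θ (a t) s))
    (hZ : IsMarkovBranchingProcess rate p ℱ P Z) (t : ℝ≥0) :
    P {ω | Z t ω = 0} = ENNReal.ofReal (1 - (thetaVariation θ rate a t +
      Real.exp (-θ * growthExponent rate a t)) ^ (-1 / θ)) := by
  have h1 := hasSum_pointProb_mul_pow h hp hpgf hZ t.coe_nonneg le_rfl zero_lt_one
  -- At s = 0 only the term `n = 0` survives, with `0 ^ 0 = 1`.
  have h2 : HasSum (fun n => pointProb P Z n t * 0 ^ n) (pointProb P Z 0 t * 0 ^ 0) :=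
    hasSum_single 0 fun n hn => by rw [zero_pow hn, mul_zero]
  have h3 := h2.unique h1
  simp only [pow_zero, mul_one, sub_zero, Real.one_rpow, one_mul] at h3
  rw [← h3, pointProb, ofReal_measureReal, Real.toNNReal_coe]

end ThetaPositive

/-! ### Criticality -/

/-- The lower bound on g forces ∫ a λ = g + Λ to infinity, and the upper bound keeps the weight
exp(-θ g) at least exp(-θ C), so the weighted integral diverges too. -/
theorem tendsto_thetaVariation_atTop {θ : ℝ} {rate a : ℝ → ℝ} (h : IsThetaEnvironment θ rate a)
    (hΛ : Tendsto (cumHazard rate) atTop atTop) {t₀ c C : ℝ} (ht₀ : 0 ≤ t₀)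
    (hc : ∀ t, t₀ ≤ t → c ≤ growthExponent rate a t)
    (hC : ∀ t, t₀ ≤ t → growthExponent rate a t ≤ C) :
    Tendsto (thetaVariation θ rate a) atTop atTop := by
  have hθ := h.theta_pos
  set I : ℝ → ℝ := fun t => ∫ u in (0 : ℝ)..t, a u * rate u with hI
  have hIeq : ∀ t, 0 ≤ t → I t = growthExponent rate a t + cumHazard rate t := fun t ht => by
    rw [growthExponent, cumHazard,
      ← intervalIntegral.integral_add (h.intervalIntegrable_growth ht) (h.rate_integrable t ht)]
    exact intervalIntegral.integral_congr fun u _ => by ring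
  set k := θ / (1 + θ) * Real.exp (-θ * C) with hk
  have hk0 : 0 < k := by positivity
  have hlow : ∀ t, t₀ ≤ t → k * (c + cumHazard rate t - I t₀) ≤ thetaVariation θ rate a t := by
    intro t ht
    have ht' := ht₀.trans ht
    have hsub : uIcc t₀ t ⊆ uIcc 0 t :=
      uIcc_subset_uIcc (by rw [uIcc_of_le ht']; exact ⟨ht₀, ht⟩) right_mem_uIcc
    have hi1 := (h.intervalIntegrable_mul ht').mono_set hsub
    have hi2 := (h.intervalIntegrable_variation ht').mono_set hsub
    have h1 : k * (I t - I t₀) ≤ thetaVariation θ rate a t - thetaVariation θ rate a t₀ := by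
      rw [hI, thetaVariation, thetaVariation,
        intervalIntegral.integral_interval_sub_left (h.intervalIntegrable_mul ht')
          (h.intervalIntegrable_mul ht₀),
        intervalIntegral.integral_interval_sub_left (h.intervalIntegrable_variation ht')
          (h.intervalIntegrable_variation ht₀), ← intervalIntegral.integral_const_mul]
      refine intervalIntegral.integral_mono_on ht (hi1.const_mul k) hi2 fun u hu => ?_
      have hu0 := ht₀.trans hu.1
      have hle : Real.exp (-θ * C) ≤ Real.exp (-θ * growthExponent rate a u) := by
        refine Real.exp_le_exp.2 ?_
        nlinarith [hC u hu.1]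
      have h3 := mul_nonneg (h.a_nonneg u hu0) (h.rate_nonneg u hu0)
      calc k * (a u * rate u) = θ / (1 + θ) * (a u * rate u * Real.exp (-θ * C)) := by
            rw [hk]; ring
        _ ≤ _ := by gcongr
    have h2 := h.thetaVariation_nonneg ht₀
    have h3 : k * (c + cumHazard rate t - I t₀) ≤ k * (I t - I t₀) := by
      refine mul_le_mul_of_nonneg_left ?_ hk0.le
      rw [hIeq t ht']
      linarith [hc t ht]
    linarith
  refine tendsto_atTop_mono' _ (eventually_atTop.2 ⟨t₀, hlow⟩) ?_
  refine Tendsto.const_mul_atTop hk0 ?_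
  exact tendsto_atTop_add_const_right _ _ (tendsto_atTop_add_const_left _ c hΛ)

/-- Z vanishes off the conditioning event, so restricting to it loses no mass of the mean. -/
theorem condMeanSize_eq {Ω : Type*} [MeasurableSpace Ω] {P : Measure Ω} {Z : ℝ≥0 → Ω → ℕ}
    {t : ℝ≥0} (hZ : Measurable (Z t)) :
    condMeanSize P Z t = (P {ω | 0 < Z t ω})⁻¹ * meanSize P Z t := by
  have hs : MeasurableSet {ω | 0 < Z t ω} := hZ (measurableSet_Ioi (a := 0))
  rw [condMeanSize, meanSize, ProbabilityTheory.cond, lintegral_smul_measure, smul_eq_mul, ← lintegral_indicator hs]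
  congr 2
  ext ω
  by_cases hω : 0 < Z t ω
  · simp [hω]
  · simp [Nat.eq_zero_of_not_pos hω]

theorem mainTheorem8 {Ω : Type*} [mΩ : MeasurableSpace Ω] (P : Measure Ω) [IsProbabilityMeasure P]
    (ℱ : Filtration ℝ≥0 mΩ) (θ : ℝ) (rate a : ℝ → ℝ) (Z : ℝ≥0 → Ω → ℕ)
    (hZ : IsThetaPositiveBranchingProcess θ rate a ℱ P Z)
    (hΛ : Tendsto (cumHazard rate) atTop atTop)
    (hinf : 0 < liminf (meanSize P Z) atTop)
    (hsup : limsup (meanSize P Z) atTop < ⊤) :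
    IsCriticalBranching P Z := by
  have henv : IsThetaEnvironment θ rate a :=
    ⟨hZ.theta_pos, hZ.rate_nonneg, hZ.rate_integrable, hZ.a_measurable, hZ.a_nonneg, hZ.a_le⟩
  have hθ := henv.theta_pos
  obtain ⟨p, hp, hpgf, hB⟩ := hZ.branching
  obtain ⟨c, hc0, hc⟩ := exists_between hinf
  obtain ⟨C, hC, hC1⟩ := exists_between hsup
  have hc1 : c ≠ ⊤ := (hc.trans_le le_top).ne
  have hlow : ∀ᶠ t in atTop, c < meanSize P Z t := eventually_lt_of_lt_liminf hc
  have hupp : ∀ᶠ t in atTop, meanSize P Z t < C := eventually_lt_of_limsup_lt hC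
  obtain ⟨t₀, ht₀⟩ := eventually_atTop.1 (hlow.and hupp)
  have hgr : ∀ t : ℝ, (t₀ : ℝ) ≤ t → c < ENNReal.ofReal (Real.exp (growthExponent rate a t)) ∧
      ENNReal.ofReal (Real.exp (growthExponent rate a t)) < C := by
    intro t ht
    lift t to ℝ≥0 using t₀.coe_nonneg.trans ht
    have h1 := ht₀ t ht
    rwa [meanSize_thetaPositive henv hp hpgf hB] at h1
  have hVar : Tendsto (thetaVariation θ rate a) atTop atTop := by
    refine tendsto_thetaVariation_atTop henv hΛ (t₀ := t₀) (c := Real.log c.toReal)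
      (C := Real.log C.toReal) t₀.coe_nonneg (fun t ht => ?_) fun t ht => ?_
    · rw [Real.log_le_iff_le_exp (ENNReal.toReal_pos hc0.ne' hc1)]
      exact (ENNReal.le_ofReal_iff_toReal_le hc1 (Real.exp_pos _).le).1 (hgr t ht).1.le
    · have h1 := (ENNReal.ofReal_le_iff_le_toReal hC1.ne).1 (hgr t ht).2.le
      rwa [Real.le_log_iff_exp_le ((Real.exp_pos _).trans_le h1)]
  have hext : Tendsto (fun t => P {ω | Z t ω = 0}) atTop (𝓝 1) := by
    simp only [measure_extinct_thetaPositive henv hp hpgf hB]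
    have h1 : Tendsto (fun t : ℝ => thetaVariation θ rate a t +
        Real.exp (-θ * growthExponent rate a t)) atTop atTop :=
      tendsto_atTop_mono (fun t => le_add_of_nonneg_right (Real.exp_pos _).le) hVar
    have h2 := ((tendsto_rpow_neg_atTop (one_div_pos.2 hθ)).comp h1).comp
      (NNReal.tendsto_coe_atTop.2 tendsto_id)
    have h3 := ENNReal.tendsto_ofReal (h2.const_sub 1)
    simpa only [sub_zero, ENNReal.ofReal_one, neg_div, Function.comp_def, id] using h3
  refine ⟨hext, ?_⟩
  have hpos : ∀ t, P {ω | 0 < Z t ω} = 1 - P {ω | Z t ω = 0} := fun t => by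
    have hs : MeasurableSet {ω | Z t ω = 0} := hB.measurable t (measurableSet_singleton 0)
    rw [← prob_compl_eq_one_sub hs]
    congr 1
    ext ω
    exact Nat.pos_iff_ne_zero
  -- Eventually m_t ≥ c / P(Z_t > 0); `c ≠ 0` is essential, since ⊤ * 0 = 0 in `ℝ≥0∞`.
  have hsurv : Tendsto (fun t => (P {ω | 0 < Z t ω})⁻¹ * c) atTop (𝓝 ⊤) := by
    have h1 : Tendsto (fun t => P {ω | 0 < Z t ω}) atTop (𝓝 0) := by
      simp only [hpos]
      simpa using ENNReal.Tendsto.sub tendsto_const_nhds hext (Or.inl ENNReal.one_ne_top)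
    have h2 := ENNReal.Tendsto.mul_const (b := c) (tendsto_inv_iff.2 h1)
      (Or.inl (by simp))
    rwa [ENNReal.inv_zero, ENNReal.top_mul hc0.ne'] at h2
  refine tendsto_nhds_top_mono hsurv ?_
  filter_upwards [hlow] with t ht
  rw [condMeanSize_eq (hB.measurable t)]
  gcongr
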